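/- Conventions. A pseudogroup $\Gamma$ on a space $T$ is a set of homeomorphisms between open subsets of $T$ that contains $\mathrm{id}_T$ and is closed under composition, inversion, restriction to open sets and combination. For $W\subset T$ open, $\Gamma|_W$ denotes the set of $g\in\Gamma$ with domain and image contained in $W$. For a set $E\subset\Gamma$ and $n\in\mathbb N$, $E_n$ is the set of compositions of at most $n$ elements of $E$ (the empty composition is $\mathrm{id}_T$). The set $E$ is symmetric if it is closed under inversion and contains the identity maps of the domains and images of its elements; a set $E\subset\Gamma|_W$ generates $\Gamma|_W$ if each $h\in\Gamma|_W$ agrees, near each point of its domain, with an element of some $E_n$. A recurrent system of compact generation of $\Gamma$ in an open set $W\subset T$ that meets every $\Gamma$-orbit is a finite symmetric set $E$ of generators of $\Gamma|_W$ such that (i) each $e\in E$ is the restriction of an element of $\Gamma$ defined on a neighbourhood of the closure in $T$ of the domain of $e$; and (ii) there are an open set $V$ with compact closure $\overline V\subset W$ and some $R\in\mathbb N$ such that for each $x\in W$ there is $w\in E_R$ with $x\in\operatorname{dom}w$ and $w(x)\in V$. (Both $W=T$ and $W$ relatively compact are allowed.) The pseudogroup $\Gamma$ is called recurrent compactly generated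 if it has such a system. A deformation of length $\le n$ of an open set $U\subset W$ is a map $h$ on $U$ such that $U$ is a disjoint union of open sets on each of which $h$ is the restriction of an element of $E_n$. For a measure $\Lambda$ on $T$ put $$\operatorname{Cat}(\Gamma|_W,\Lambda,E,n)=\inf_{\mathcal U,(h^U)}\ \sum_{U\in\mathcal U}\Lambda(h^U(U))\in[0,\infty],$$ where $\mathcal U$ runs over the coverings of $W$ by open subsets of $W$ and, for each $U\in\mathcal U$, $h^U$ runs over the deformations of $U$ of length $\le n$. For non-decreasing sequences $g,h:\mathbb N\to[0,\infty]$ write $g\preceq h$ if there are $A>0$ and $B\in\mathbb N$ with $g(n)\le A\,h(Bn)$ for all $n$; the growth type $[g]$ is the class of $g$ for the relation $g\preceq h\preceq g$. With $1/0=\infty$ and $1/\infty=0$, put $$\operatorname{Cat}_{\mathrm{II}}(\Gamma,\Lambda,W,E)=[\,n\mapsto 1/\operatorname{Cat}(\Gamma|_W,\Lambda,E,n)\,].$$ A Haefliger equivalence from $(\Gamma,T)$ to $(\Gamma',T')$ is a set $\Phi$ of homeomorphisms from open subsets of $T$ onto open subsets of $T'$ whose domains cover $T$ and whose images cover $T'$,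 with $g'\varphi g\in\Phi$, $\psi^{-1}\varphi\in\Gamma$ and $\psi\varphi^{-1}\in\Gamma'$ for all $\varphi,\psi\in\Phi$, $g\in\Gamma$, $g'\in\Gamma'$. It is measure preserving, for measures $\Lambda$ on $T$ and $\Lambda'$ on $T'$, if $\Lambda'(\varphi(B))=\Lambda(B)$ for all $\varphi\in\Phi$ and all Borel $B\subset\operatorname{dom}\varphi$. The measure $\Lambda$ is $\Gamma$-invariant if $\Lambda(g(B))=\Lambda(B)$ for all $g\in\Gamma$ and all Borel $B\subset\operatorname{dom}g$. Proposition. Let $\Gamma,\Gamma'$ be recurrent compactly generated pseudogroups on locally compact Polish spaces $T,T'$, and let $\Lambda,\Lambda'$ be invariant Borel measures of $\Gamma,\Gamma'$ that are finite on compact sets. If there is a measure preserving Haefliger equivalence from $(\Gamma,T,\Lambda)$ to $(\Gamma',T',\Lambda')$, then $$\operatorname{Cat}_{\mathrm{II}}(\Gamma,\Lambda,W,E)=\operatorname{Cat}_{\mathrm{II}}(\Gamma',\Lambda',W',E')$$ for all recurrent systems of compact generation $E$ of $\Gamma$ in $W$ and $E'$ of $\Gamma'$ in $W'$. In particular (taking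 the identity equivalence) $\operatorname{Cat}_{\mathrm{II}}(\Gamma,\Lambda)$ does not depend on the choice of $(W,E)$, and it is invariant under measure preserving Haefliger equivalences. -/

import Mathlib

open Set MeasureTheory Topology
open scoped ENNReal NNReal

/-! ### Growth types of non-decreasing sequences -/

/-- A non-decreasing sequence `ℕ → [0, ∞]`.  The value `∞` is allowed so that `1 / Cat` makes sense
also when `Cat = 0`. -/
structure GrowthSeq where
  toFun : ℕ → ℝ≥0∞
  mono : Monotone toFun

/-- `g ≼ h` if there are `B ∈ ℕ` and `A > 0` with `g n ≤ A * h (B * n)` for all `n`. -/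
instance GrowthSeq.instPreorder : Preorder GrowthSeq where
  le g h := ∃ B : ℕ, ∃ A : ℝ≥0, 0 < A ∧ ∀ n, g.toFun n ≤ A * h.toFun (B * n)
  le_refl g := ⟨1, 1, one_pos, fun n => by simp⟩
  le_trans := by
    rintro g h k ⟨B, A, hA, H⟩ ⟨B', A', hA', H'⟩
    refine ⟨B' * B, A * A', mul_pos hA hA', fun n => ?_⟩
    calc g.toFun n ≤ A * h.toFun (B * n) := H n
      _ ≤ A * (A' * k.toFun (B' * (B * n))) := by gcongr; exact H' _
      _ = _ := by rw [← mul_assoc, ← mul_assoc, ENNReal.coe_mul]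

/-- Growth types: classes of sequences under `g ≃ h ↔ g ≼ h ∧ h ≼ g`. -/
abbrev GrowthType : Type := Antisymmetrization GrowthSeq (· ≤ ·)

/-- The growth type of a non-decreasing sequence. -/
def growthType (g : GrowthSeq) : GrowthType := toAntisymmetrization (· ≤ ·) g

section Pseudogroup

/-! ### Pseudogroups

A pseudogroup of local transformations of `T` is a `StructureGroupoid T` that is closed under
restriction to open sets: it contains the identity and is closed under composition, inversion,
restriction and combination.  Composition `e'` after `e` is `e.trans e'`; `e ≈ e'` says that two
open partial homeomorphisms have the same domain and agree on it.

The restriction of a pseudogroup `Γ` on `T` to an open set `W` consists of the `g ∈ Γ` with domain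
and image contained in `W`; it is the whole of `Γ` for `W = univ`. -/

variable {T : Type*} [TopologicalSpace T]

/-- Compositions of at most `n` elements of `E`, with their natural domains; the empty composition
is the identity. -/
def words (E : Set (OpenPartialHomeomorph T T)) (n : ℕ) : Set (OpenPartialHomeomorph T T) :=
  {w | ∃ l : List (OpenPartialHomeomorph T T), l.length ≤ n ∧ (∀ e ∈ l, e ∈ E) ∧
    w = l.foldr (fun e f => e.trans f) (OpenPartialHomeomorph.refl T)}

theorem words_mono (E : Set (OpenPartialHomeomorph T T)) : Monotone (words E) := by
  rintro m n hmn w ⟨l, hl, hE, hw⟩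
  exact ⟨l, hl.trans hmn, hE, hw⟩

/-- A symmetric family: it is closed under inversion and contains the identity maps of the domains
(hence also of the images) of its elements. -/
def IsSymmetricFamily (E : Set (OpenPartialHomeomorph T T)) : Prop :=
  (∀ e ∈ E, ∃ e' ∈ E, e' ≈ e.symm) ∧
    ∀ e ∈ E, ∃ e' ∈ E, e' ≈ OpenPartialHomeomorph.ofSet e.source e.open_source

/-- `E` generates the restriction of `Γ` to `W`: its elements belong to that restriction, and each
element of that restriction is a combination of restrictions of compositions of elements of `E`,
that is, near each point of its domain it agrees with a composition of elements of `E`. -/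
structure Generates (Γ : StructureGroupoid T) (W : Set T)
    (E : Set (OpenPartialHomeomorph T T)) : Prop where
  mem : ∀ e ∈ E, e ∈ Γ
  source_subset : ∀ e ∈ E, e.source ⊆ W
  target_subset : ∀ e ∈ E, e.target ⊆ W
  locally_word : ∀ h ∈ Γ, h.source ⊆ W → h.target ⊆ W → ∀ x ∈ h.source,
    ∃ n, ∃ w ∈ words E n, x ∈ w.source ∧ (h : T → T) =ᶠ[𝓝 x] w

/-- `E` is recurrent on `W`: there are a relatively compact open `V` in `W` and a bound `R` such
that each point of `W` is brought into `V` by a transformation of `E`-length at most `R`. -/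
def IsRecurrent (W : Set T) (E : Set (OpenPartialHomeomorph T T)) : Prop :=
  ∃ V : Set T, IsOpen V ∧ IsCompact (closure V) ∧ closure V ⊆ W ∧
    ∃ R : ℕ, ∀ x ∈ W, ∃ w ∈ words E R, x ∈ w.source ∧ w x ∈ V

/-- A recurrent system of compact generation of `Γ` in `W`: `W` is open and meets each orbit, and
`E` is a finite symmetric recurrent family generating the restriction of `Γ` to `W`, each element
of which is the restriction of an element of `Γ` defined on a neighbourhood of the closure of its
domain.

`W` need not be relatively compact, so that two cases are covered: `W = univ`, where `E` is a
recurrent system of generators of `Γ` itself, and `W` relatively compact, where `E` is a system of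
compact generation of `Γ` in the usual sense. -/
structure IsRecurrentSystem (Γ : StructureGroupoid T) (W : Set T)
    (E : Set (OpenPartialHomeomorph T T)) : Prop where
  isOpen : IsOpen W
  meets_orbits : ∀ x : T, ∃ g ∈ Γ, x ∈ g.source ∧ g x ∈ W
  finite : E.Finite
  symmetric : IsSymmetricFamily E
  generates : Generates Γ W E
  extends_to_closure : ∀ e ∈ E, ∃ f ∈ Γ, closure e.source ⊆ f.source ∧ EqOn f e e.source
  recurrent : IsRecurrent W E

/-- `h` is a deformation of `U` of `E`-length at most `n`: `U` is a disjoint union of open sets on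
each of which `h` is the restriction of a composition of at most `n` elements of `E`. -/
def IsDeformation (E : Set (OpenPartialHomeomorph T T)) (n : ℕ) (U : Set T) (h : T → T) : Prop :=
  ∃ C : Set (Set T), (∀ c ∈ C, IsOpen c) ∧ C.PairwiseDisjoint id ∧ ⋃₀ C = U ∧
    ∀ c ∈ C, ∃ w ∈ words E n, c ⊆ w.source ∧ EqOn h w c

/-- `𝒰` is a covering of `W` by open subsets of `W`. -/
def IsOpenCovering (W : Set T) (𝒰 : Set (Set T)) : Prop :=
  (∀ U ∈ 𝒰, IsOpen U) ∧ ⋃₀ 𝒰 = W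

variable [MeasurableSpace T]

/-- `Λ` is invariant under `Γ`. -/
def IsInvariantMeasure (Γ : StructureGroupoid T) (Λ : Measure T) : Prop :=
  ∀ g ∈ Γ, ∀ B : Set T, MeasurableSet B → B ⊆ g.source → Λ (g '' B) = Λ B

/-- `Cat(Γ|_W, Λ, E, n)`, for a family `E` of generators of the restriction of `Γ` to `W`: the
infimum of `∑ Λ (h^U (U))` over the open coverings `𝒰` of `W` and the deformations `h^U` of length
at most `n` of the sets `U ∈ 𝒰`. -/
noncomputable def measuredCat (Λ : Measure T) (W : Set T)
    (E : Set (OpenPartialHomeomorph T T)) (n : ℕ) : ℝ≥0∞ :=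
  ⨅ (𝒰 : Set (Set T)) (h : Set T → T → T) (_ : IsOpenCovering W 𝒰)
    (_ : ∀ U ∈ 𝒰, IsDeformation E n U (h U)), ∑' U : 𝒰, Λ (h U '' (U : Set T))

theorem measuredCat_antitone (Λ : Measure T) (W : Set T)
    (E : Set (OpenPartialHomeomorph T T)) : Antitone (measuredCat Λ W E) := by
  intro m n hmn
  refine iInf_mono fun 𝒰 => iInf_mono fun h => iInf_mono fun _ => iInf_mono' fun hd => ⟨?_, le_rfl⟩
  intro U hU
  obtain ⟨C, h1, h2, h3, h4⟩ := hd U hU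
  refine ⟨C, h1, h2, h3, fun c hc => ?_⟩
  obtain ⟨w, hw, hw'⟩ := h4 c hc
  exact ⟨w, words_mono E hmn hw, hw'⟩

/-- The secondary category: the growth type of `n ↦ 1 / Cat(Γ|_W, Λ, E, n)`. -/
noncomputable def secondaryCat (Λ : Measure T) (W : Set T)
    (E : Set (OpenPartialHomeomorph T T)) : GrowthType :=
  growthType ⟨fun n => (measuredCat Λ W E n)⁻¹,
    fun _ _ hmn => ENNReal.inv_le_inv.2 (measuredCat_antitone Λ W E hmn)⟩

end Pseudogroup

section Equivalence

variable {T T' : Type*} [TopologicalSpace T] [TopologicalSpace T']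

/-- A Haefliger equivalence between pseudogroups `Γ` on `T` and `Γ'` on `T'`: a collection of
homeomorphisms from open subsets of `T` onto open subsets of `T'` whose domains cover `T` and whose
images cover `T'`, closed under composition with elements of `Γ` and `Γ'`, and such that the
transition maps belong to `Γ` and `Γ'`.  (Such a collection is contained in exactly one maximal one;
maximality is not required.) -/
structure IsHaefligerEquivalence (Γ : StructureGroupoid T) (Γ' : StructureGroupoid T')
    (Φ : Set (OpenPartialHomeomorph T T')) : Prop where
  cover_source : ∀ x : T, ∃ φ ∈ Φ, x ∈ φ.source
  cover_target : ∀ y : T', ∃ φ ∈ Φ, y ∈ φ.target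
  comp_mem : ∀ φ ∈ Φ, ∀ g ∈ Γ, ∀ g' ∈ Γ', (g.trans φ).trans g' ∈ Φ
  transition_mem : ∀ φ ∈ Φ, ∀ ψ ∈ Φ, φ.trans ψ.symm ∈ Γ
  transition_mem' : ∀ φ ∈ Φ, ∀ ψ ∈ Φ, φ.symm.trans ψ ∈ Γ'

/-- All maps of `Φ` preserve the measures. -/
def IsMeasurePreservingEquivalence [MeasurableSpace T] [MeasurableSpace T']
    (Φ : Set (OpenPartialHomeomorph T T')) (Λ : Measure T) (Λ' : Measure T') : Prop :=
  ∀ φ ∈ Φ, ∀ B : Set T, MeasurableSet B → B ⊆ φ.source → Λ' (φ '' B) = Λ B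

end Equivalence

/-! ### Compositions of generators and reachability in bounded length -/

section Words

variable {T : Type*} [TopologicalSpace T] {E : Set (OpenPartialHomeomorph T T)}

/-! The category at length `n` is the infimum of `Λ S` over the open sets `S` that every point of
`W` reaches by a word of length at most `n` (`exists_isOpen_reached_of_measuredCat_lt`,
`measuredCat_le_of_reaches`). Coverings and deformations thus disappear, and only the lengths of
words matter.

Recurrence brings each point of `W` in at most `R` steps into a compact set, which finitely many
compact pieces of domains of maps of `Φ` cover. Since generators extend over the closures of their
domains, compactness bounds the `E'`-length of the transports of the finitely many words of length
at most `2R + 1` (`exists_length_bound`). Returning to the pieces after each letter, a word of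
length `n` is followed in `W'` by a word of length `C * n` (`reaches_of_reaches`).

Hence finitely many transports of `S` form a set reached from all of `W'` in `B + C * n` steps, of
measure at most `m * Λ S` by invariance (`exists_measuredCat_le`). Passing to growth types absorbs
`B`, and the inverse equivalence gives the other inequality. -/

theorem refl_mem_words (E : Set (OpenPartialHomeomorph T T)) (n : ℕ) :
    OpenPartialHomeomorph.refl T ∈ words E n :=
  ⟨[], by simp, by simp, rfl⟩

theorem trans_mem_words {e w : OpenPartialHomeomorph T T} {n : ℕ} (he : e ∈ E)
    (hw : w ∈ words E n) : e.trans w ∈ words E (n + 1) := by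
  obtain ⟨l, hl, hE, rfl⟩ := hw
  exact ⟨e :: l, by simpa using hl, by simpa [he] using hE, rfl⟩

/-- Induction on words, adding letters that act first. -/
theorem words_induction {P : ℕ → OpenPartialHomeomorph T T → Prop}
    (hrefl : ∀ n, P n (OpenPartialHomeomorph.refl T))
    (htrans : ∀ n, ∀ e ∈ E, ∀ w ∈ words E n, P n w → P (n + 1) (e.trans w)) :
    ∀ n, ∀ w ∈ words E n, P n w := by
  rintro n w ⟨l, hl, hE, rfl⟩
  induction l generalizing n with
  | nil => exact hrefl n
  | cons e l ih =>
    obtain ⟨m, rfl⟩ : ∃ m, n = m + 1 := ⟨n - 1, by simp at hl; omega⟩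
    have hl' : l.length ≤ m := by simpa using hl
    have hE' : ∀ a ∈ l, a ∈ E := fun a ha => hE a (List.mem_cons_of_mem _ ha)
    exact htrans m e (hE e List.mem_cons_self) _ ⟨l, hl', hE', rfl⟩ (ih m hl' hE')

theorem words_finite (hE : E.Finite) (n : ℕ) : (words E n).Finite := by
  induction n with
  | zero =>
    refine (finite_singleton (OpenPartialHomeomorph.refl T)).subset ?_
    rintro w ⟨l, hl, -, rfl⟩
    obtain rfl : l = [] := by simpa using hl
    rfl
  | succ n ih =>
    refine ((finite_singleton (OpenPartialHomeomorph.refl T)).union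
      (hE.image2 (fun e w => e.trans w) ih)).subset ?_
    rintro w ⟨l, hl, hE', rfl⟩
    cases l with
    | nil => exact Or.inl rfl
    | cons e l =>
      exact Or.inr ⟨e, hE' e List.mem_cons_self, _,
        ⟨l, by simpa using hl, fun a ha => hE' a (List.mem_cons_of_mem _ ha), rfl⟩, rfl⟩

theorem words_subset {Γ : StructureGroupoid T} (hE : ∀ e ∈ E, e ∈ Γ) :
    ∀ n, ∀ w ∈ words E n, w ∈ Γ :=
  words_induction (fun _ => Γ.id_mem) fun _ e he _ _ hw => Γ.trans (hE e he) hw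

/-- If the elements of `E` extend over the closures of their domains, so do the compositions. -/
theorem words_extend {Γ : StructureGroupoid T}
    (hE : ∀ e ∈ E, ∃ f ∈ Γ, closure e.source ⊆ f.source ∧ EqOn f e e.source) :
    ∀ n, ∀ w ∈ words E n, ∃ f ∈ Γ, closure w.source ⊆ f.source ∧ EqOn f w w.source := by
  refine words_induction (fun _ => ⟨_, Γ.id_mem, by simp, fun x _ => rfl⟩) ?_
  rintro n e he w - ⟨f, hf, hfw, hfe⟩
  obtain ⟨k, hk, hke, hkeq⟩ := hE e he
  refine ⟨k.trans f, Γ.trans hk hf, fun x hx => ?_, fun x hx => ?_⟩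
  · have hsub : (e.trans w).source ⊆ e.source := by
      rw [OpenPartialHomeomorph.trans_source]; exact inter_subset_left
    have hxk : x ∈ k.source := hke (closure_mono hsub hx)
    rw [OpenPartialHomeomorph.trans_source]
    refine ⟨hxk, hfw ?_⟩
    -- By continuity `k x` is a limit of points `k y = e y` of `w.source`.
    refine closure_mono ?_
      ((k.continuousAt hxk).continuousWithinAt.mem_closure_image hx)
    rintro _ ⟨y, hy, rfl⟩
    rw [OpenPartialHomeomorph.trans_source] at hy
    rw [hkeq hy.1]
    exact hy.2
  · rw [OpenPartialHomeomorph.trans_source] at hx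
    have h2 : e x ∈ w.source := hx.2
    simp only [OpenPartialHomeomorph.coe_trans, Function.comp]
    rw [hkeq hx.1, hfe h2]

/-- `y` is the image of `x` under a composition of at most `n` elements of `E`. -/
def Reaches (E : Set (OpenPartialHomeomorph T T)) (n : ℕ) (x y : T) : Prop :=
  ∃ w ∈ words E n, x ∈ w.source ∧ w x = y

theorem Reaches.refl (n : ℕ) (x : T) : Reaches E n x x :=
  ⟨_, refl_mem_words E n, by simp, rfl⟩

theorem Reaches.mono {m n : ℕ} {x y : T} (h : Reaches E m x y) (hmn : m ≤ n) :
    Reaches E n x y := by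
  obtain ⟨w, hw, h⟩ := h
  exact ⟨w, words_mono E hmn hw, h⟩

theorem Reaches.cons {n : ℕ} {e : OpenPartialHomeomorph T T} {x y : T} (he : e ∈ E)
    (hx : x ∈ e.source) (h : Reaches E n (e x) y) : Reaches E (n + 1) x y := by
  obtain ⟨w, hw, hxw, rfl⟩ := h
  refine ⟨e.trans w, trans_mem_words he hw, ?_, rfl⟩
  rw [OpenPartialHomeomorph.trans_source]
  exact ⟨hx, hxw⟩

theorem Reaches.trans {m n : ℕ} {x y z : T} (h : Reaches E m x y) (h' : Reaches E n y z) :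
    Reaches E (m + n) x z := by
  obtain ⟨w, hw, hx, hxy⟩ := h
  refine words_induction (P := fun m w => ∀ x, x ∈ w.source → w x = y → Reaches E (m + n) x z)
    (fun m x _ hxy => ?_) (fun m e he w _ ih x hx hxy => ?_) m w hw x hx hxy
  · obtain rfl : x = y := hxy
    exact h'.mono (by omega)
  · rw [OpenPartialHomeomorph.trans_source] at hx
    exact ((ih (e x) hx.2 hxy).cons he hx.1).mono (by omega)

theorem Reaches.symm (hE : IsSymmetricFamily E) {n : ℕ} {x y : T} (h : Reaches E n x y) :
    Reaches E n y x := by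
  obtain ⟨w, hw, hx, hxy⟩ := h
  refine words_induction (P := fun n w => ∀ x, x ∈ w.source → w x = y → Reaches E n y x)
    (fun m x _ hxy => ?_) (fun m e he w _ ih x hx hxy => ?_) n w hw x hx hxy
  · obtain rfl : x = y := hxy
    exact Reaches.refl _ _
  · rw [OpenPartialHomeomorph.trans_source] at hx
    obtain ⟨e', he', hee'⟩ := hE.1 e he
    have hex : e x ∈ e'.source := by
      rw [hee'.1]; exact e.map_source hx.1
    refine (ih (e x) hx.2 hxy).trans (Reaches.cons he' hex ?_)
    rw [hee'.2 hex, e.left_inv hx.1]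
    exact Reaches.refl _ _

end Words

/-! ### The category as an infimum over reached open sets -/

section Category

variable {T : Type*} [TopologicalSpace T]

/-- In a pseudometrizable second countable space with a `σ`-finite measure, an open set is, up to a
null set, a disjoint union of small open sets. -/
theorem exists_disjoint_small_open [TopologicalSpace.PseudoMetrizableSpace T]
    [SecondCountableTopology T] [MeasurableSpace T] [BorelSpace T]
    (μ : Measure T) [SFinite μ] {W : Set T} (hW : IsOpen W) {P : Set T → Prop}
    (hP : ∀ O O', O ⊆ O' → P O' → P O) (hloc : ∀ x ∈ W, ∃ O, IsOpen O ∧ x ∈ O ∧ P O) :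
    ∃ C : Set (Set T), (∀ c ∈ C, IsOpen c ∧ c ⊆ W ∧ P c) ∧ C.PairwiseDisjoint id ∧
      μ (W \ ⋃₀ C) = 0 := by
  let _ := TopologicalSpace.pseudoMetrizableSpacePseudoMetric T
  have hball : ∀ x ∈ W, ∃ B, IsOpen B ∧ x ∈ B ∧ B ⊆ W ∧ P B ∧ μ (frontier B) = 0 := by
    intro x hx
    obtain ⟨O, hO, hxO, hPO⟩ := hloc x hx
    obtain ⟨ε, hε, hεO⟩ := Metric.isOpen_iff.1 (hO.inter hW) x ⟨hxO, hx⟩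
    -- Some radius below `ε` has a null frontier.
    obtain ⟨r, hr, hr0⟩ := exists_null_frontier_thickening μ {x} hε
    rw [Metric.thickening_singleton] at hr0
    have hsub : Metric.ball x r ⊆ O ∩ W := (Metric.ball_subset_ball hr.2.le).trans hεO
    exact ⟨_, Metric.isOpen_ball, Metric.mem_ball_self hr.1, hsub.trans inter_subset_right,
      hP _ _ (hsub.trans inter_subset_left) hPO, hr0⟩
  choose! B hBo hxB hBW hPB hB0 using hball
  obtain ⟨t, htW, htc, htcov⟩ := TopologicalSpace.countable_cover_nhdsWithin
    (f := B) (s := W) fun x hx => mem_nhdsWithin_of_mem_nhds ((hBo x hx).mem_nhds (hxB x hx))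
  rcases t.eq_empty_or_nonempty with rfl | hne
  · obtain rfl : W = ∅ := by simpa using htcov
    exact ⟨∅, by simp, by simp, by simp⟩
  obtain ⟨u, rfl⟩ := htc.exists_eq_range hne
  have huW : ∀ i, u i ∈ W := fun i => htW (mem_range_self i)
  -- Removing the closures of the earlier balls, rather than the balls, keeps the sets open; only
  -- points of the null frontiers are lost.
  set G : ℕ → Set T := fun i => B (u i) \ ⋃ j ∈ Finset.range i, closure (B (u j)) with hG
  have hdisj : ∀ i j, i < j → Disjoint (G i) (G j) := by
    intro i j hij
    rw [Set.disjoint_left]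
    rintro x ⟨hxi, -⟩ ⟨-, hxj⟩
    exact hxj (mem_biUnion (Finset.mem_coe.2 (Finset.mem_range.2 hij)) (subset_closure hxi))
  refine ⟨range G, ?_, ?_, ?_⟩
  · rintro _ ⟨i, rfl⟩
    refine ⟨(hBo _ (huW i)).sdiff ?_, sdiff_subset.trans (hBW _ (huW i)),
      hP _ _ sdiff_subset (hPB _ (huW i))⟩
    exact (Finset.range i).finite_toSet.isClosed_biUnion fun _ _ => isClosed_closure
  · rintro _ ⟨i, rfl⟩ _ ⟨j, rfl⟩ hne
    rcases lt_trichotomy i j with h | rfl | h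
    · exact hdisj i j h
    · exact absurd rfl hne
    · exact (hdisj j i h).symm
  · refine measure_mono_null (t := ⋃ i, frontier (B (u i))) ?_
      (measure_iUnion_null fun i => hB0 _ (huW i))
    rintro x ⟨hxW, hx⟩
    by_contra hfr
    have hex : ∃ i, x ∈ B (u i) := by
      obtain ⟨_, ⟨i, rfl⟩, hi⟩ := mem_iUnion₂.1 (htcov hxW)
      exact ⟨i, hi⟩
    classical
    refine hx ⟨G (Nat.find hex), mem_range_self _, Nat.find_spec hex, fun hxc => ?_⟩
    obtain ⟨j, hj, hxj⟩ := mem_iUnion₂.1 hxc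
    have hjn := Nat.find_min hex (Finset.mem_range.1 hj)
    refine hfr (mem_iUnion.2 ⟨j, ?_⟩)
    rw [(hBo _ (huW j)).frontier_eq]
    exact ⟨hxj, hjn⟩

theorem IsDeformation.isOpen_image {E : Set (OpenPartialHomeomorph T T)} {n : ℕ} {U : Set T}
    {h : T → T} (hd : IsDeformation E n U h) : IsOpen (h '' U) := by
  obtain ⟨C, hCo, -, rfl, hC⟩ := hd
  rw [sUnion_eq_biUnion, image_iUnion₂]
  refine isOpen_biUnion fun c hc => ?_
  obtain ⟨w, -, hcw, heq⟩ := hC c hc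
  rw [heq.image_eq]
  exact w.isOpen_image_of_subset_source (hCo c hc) hcw

theorem IsDeformation.reaches {E : Set (OpenPartialHomeomorph T T)} {n : ℕ} {U : Set T}
    {h : T → T} (hd : IsDeformation E n U h) {x : T} (hx : x ∈ U) : Reaches E n x (h x) := by
  obtain ⟨C, -, -, rfl, hC⟩ := hd
  obtain ⟨c, hc, hxc⟩ := hx
  obtain ⟨w, hw, hcw, heq⟩ := hC c hc
  exact ⟨w, hw, hcw hxc, (heq hxc).symm⟩

theorem isDeformation_id {E : Set (OpenPartialHomeomorph T T)} {n : ℕ} {U : Set T}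
    (hU : IsOpen U) : IsDeformation E n U id :=
  ⟨{U}, by simpa using hU, by simp, by simp, fun c _ =>
    ⟨_, refl_mem_words E n, by simp, fun x _ => rfl⟩⟩

variable [MeasurableSpace T]

/-- The category dominates the infimum of the measures of open sets that are reached from each point
of `W`. -/
theorem exists_isOpen_reached_of_measuredCat_lt [SecondCountableTopology T] {Λ : Measure T}
    {W : Set T} {E : Set (OpenPartialHomeomorph T T)} {n : ℕ} {a : ℝ≥0∞}
    (h : measuredCat Λ W E n < a) :
    ∃ S, IsOpen S ∧ Λ S < a ∧ ∀ x ∈ W, ∃ y ∈ S, Reaches E n x y := by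
  simp only [measuredCat, iInf_lt_iff] at h
  obtain ⟨𝒰, h, ⟨hUo, hUW⟩, hd, hlt⟩ := h
  -- `𝒰` may be uncountable; the Lindelöf property gives a countable subcovering, so that
  -- subadditivity applies.
  obtain ⟨𝒱, h𝒱c, h𝒱, hcov⟩ : ∃ 𝒱 : Set (Set T), 𝒱.Countable ∧ 𝒱 ⊆ 𝒰 ∧ ⋃₀ 𝒱 = ⋃₀ 𝒰 :=
    TopologicalSpace.isOpen_sUnion_countable 𝒰 hUo
  refine ⟨⋃ U ∈ 𝒱, h U '' U, isOpen_biUnion fun U hU => (hd U (h𝒱 hU)).isOpen_image, ?_, ?_⟩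
  · refine lt_of_le_of_lt (measure_biUnion_le Λ h𝒱c _) (lt_of_le_of_lt ?_ hlt)
    exact ENNReal.tsum_mono_subtype (fun U => Λ (h U '' U)) h𝒱
  · intro x hx
    rw [← hUW, ← hcov] at hx
    obtain ⟨U, hU, hxU⟩ := hx
    exact ⟨h U x, mem_biUnion hU (mem_image_of_mem _ hxU), (hd U (h𝒱 hU)).reaches hxU⟩

/-- The category is at most the measure of an open set that is reached from each point of `W`. -/
theorem measuredCat_le_of_reaches [PolishSpace T] [BorelSpace T] {Λ : Measure T}
    [SFinite Λ] [Λ.OuterRegular] {W : Set T} (hW : IsOpen W)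
    {E : Set (OpenPartialHomeomorph T T)} {n : ℕ} {S : Set T} (hS : IsOpen S)
    (h : ∀ x ∈ W, ∃ y ∈ S, Reaches E n x y) : measuredCat Λ W E n ≤ Λ S := by
  obtain ⟨C, hC, hdisj, hnull⟩ := exists_disjoint_small_open Λ hW
    (P := fun O => ∃ w ∈ words E n, O ⊆ w.source ∧ w '' O ⊆ S) (by
      rintro O O' hOO' ⟨w, hw, h1, h2⟩
      exact ⟨w, hw, hOO'.trans h1, (image_mono hOO').trans h2⟩) (by
      intro x hx
      obtain ⟨_, hy, w, hw, hxw, rfl⟩ := h x hx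
      refine ⟨w.source ∩ w ⁻¹' S, w.isOpen_inter_preimage hS, ⟨hxw, hy⟩, w, hw,
        inter_subset_left, ?_⟩
      rintro _ ⟨z, hz, rfl⟩
      exact hz.2)
  choose hCo hCW w hw hcw hwS using hC
  classical
  obtain ⟨k, hk⟩ : ∃ k : T → T, ∀ c (hc : c ∈ C), EqOn k (w c hc) c := by
    refine ⟨fun x => if hx : ∃ c, c ∈ C ∧ x ∈ c then w hx.choose hx.choose_spec.1 x else x,
      fun c hc x hx => ?_⟩
    have hex : ∃ c, c ∈ C ∧ x ∈ c := ⟨c, hc, hx⟩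
    have hceq : hex.choose = c := hdisj.elim_set hex.choose_spec.1 hc x hex.choose_spec.2 hx
    simp only [dif_pos hex]
    congr! 2
  have hkS : k '' ⋃₀ C ⊆ S := by
    rintro _ ⟨x, ⟨c, hc, hx⟩, rfl⟩
    rw [hk c hc hx]
    exact hwS c hc (mem_image_of_mem _ hx)
  have hU : IsOpen (⋃₀ C) := isOpen_sUnion hCo
  have hkd : IsDeformation E n (⋃₀ C) k :=
    ⟨C, hCo, hdisj, rfl, fun c hc => ⟨w c hc, hw c hc, hcw c hc, hk c hc⟩⟩
  refine ENNReal.le_of_forall_pos_le_add fun ε hε _ => ?_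
  -- The null remainder lies in an open set of measure below `ε`, on which the identity serves as
  -- deformation.
  obtain ⟨G, hNG, hGo, hG⟩ := (W \ ⋃₀ C).exists_isOpen_lt_of_lt (μ := Λ) ε (by
    rw [hnull]; exact_mod_cast hε)
  set V := G ∩ W
  have hVo : IsOpen V := hGo.inter hW
  have hcov : IsOpenCovering W {⋃₀ C, V} := by
    refine ⟨by simp [hU, hVo], ?_⟩
    rw [sUnion_pair]
    refine Subset.antisymm (union_subset (sUnion_subset hCW) inter_subset_right) fun x hx => ?_
    by_cases hxU : x ∈ ⋃₀ C
    · exact Or.inl hxU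
    · exact Or.inr ⟨hNG ⟨hx, hxU⟩, hx⟩
  -- The deformation is indexed by the set itself, so the case where `V` and `⋃₀ C` coincide has to
  -- be treated apart.
  set H : Set T → T → T := fun U => if U = ⋃₀ C then k else id with hH
  refine (iInf₂_le_of_le {⋃₀ C, V} H <| iInf₂_le_of_le hcov ?_ le_rfl).trans ?_
  · rintro U (rfl | rfl)
    · simpa [hH] using hkd
    · by_cases hVC : V = ⋃₀ C
      · rw [hVC]; simpa [hH] using hkd
      · simpa [hH, hVC] using isDeformation_id hVo
  · by_cases hVC : V = ⋃₀ C
    · rw [hVC, pair_eq_singleton, tsum_singleton (⋃₀ C) fun U => Λ (H U '' U)]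
      simp only [hH, if_true]
      exact (measure_mono hkS).trans le_self_add
    · rw [insert_eq]
      refine (ENNReal.tsum_union_le (fun U => Λ (H U '' U)) _ _).trans ?_
      rw [tsum_singleton (⋃₀ C) fun U => Λ (H U '' U), tsum_singleton V fun U => Λ (H U '' U)]
      simp only [hH, if_true, if_neg hVC, image_id]
      exact add_le_add (measure_mono hkS) ((measure_mono inter_subset_left).trans hG.le)

end Category

theorem measure_biUnion_le_card_mul {ι T : Type*} [MeasurableSpace T] (μ : Measure T) {I : Set ι}
    (hI : I.Finite) {s : ι → Set T} {a : ℝ≥0∞} (h : ∀ i ∈ I, μ (s i) ≤ a) :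
    μ (⋃ i ∈ I, s i) ≤ (I.ncard : ℝ≥0∞) * a := by
  have hU : ⋃ i ∈ I, s i = ⋃ i ∈ hI.toFinset, s i := by simp
  rw [hU]
  refine (measure_biUnion_finset_le _ _).trans ?_
  refine (Finset.sum_le_card_nsmul _ _ a fun i hi => h i (by simpa using hi)).trans ?_
  rw [ncard_eq_toFinset_card I hI, nsmul_eq_mul]

/-! ### Transport of words along a Haefliger equivalence -/

section Comparison

theorem StructureGroupoid.restr_refl_mem {T : Type*} [TopologicalSpace T] (Γ : StructureGroupoid T)
    [ClosedUnderRestriction Γ] {U : Set T} (hU : IsOpen U) :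
    (OpenPartialHomeomorph.refl T).restr U ∈ Γ :=
  closedUnderRestriction' Γ.id_mem hU

variable {T T' : Type*} [TopologicalSpace T] [TopologicalSpace T']
  {Γ : StructureGroupoid T} {Γ' : StructureGroupoid T'}
  {Φ : Set (OpenPartialHomeomorph T T')} {W : Set T} {E : Set (OpenPartialHomeomorph T T)}
  {W' : Set T'} {E' : Set (OpenPartialHomeomorph T' T')}

theorem IsHaefligerEquivalence.symm (hΦ : IsHaefligerEquivalence Γ Γ' Φ) :
    IsHaefligerEquivalence Γ' Γ (OpenPartialHomeomorph.symm '' Φ) where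
  cover_source y := by
    obtain ⟨φ, hφ, hy⟩ := hΦ.cover_target y
    exact ⟨φ.symm, mem_image_of_mem _ hφ, hy⟩
  cover_target x := by
    obtain ⟨φ, hφ, hx⟩ := hΦ.cover_source x
    exact ⟨φ.symm, mem_image_of_mem _ hφ, hx⟩
  comp_mem := by
    rintro _ ⟨φ, hφ, rfl⟩ g' hg' g hg
    refine ⟨_, hΦ.comp_mem φ hφ g.symm (Γ.symm hg) g'.symm (Γ'.symm hg'), ?_⟩
    simp only [OpenPartialHomeomorph.trans_symm_eq_symm_trans_symm,
      OpenPartialHomeomorph.symm_symm, OpenPartialHomeomorph.trans_assoc]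
  transition_mem := by
    rintro _ ⟨φ, hφ, rfl⟩ _ ⟨ψ, hψ, rfl⟩
    simpa using hΦ.transition_mem' φ hφ ψ hψ
  transition_mem' := by
    rintro _ ⟨φ, hφ, rfl⟩ _ ⟨ψ, hψ, rfl⟩
    simpa using hΦ.transition_mem φ hφ ψ hψ

theorem IsHaefligerEquivalence.restr_mem [ClosedUnderRestriction Γ] [ClosedUnderRestriction Γ']
    (hΦ : IsHaefligerEquivalence Γ Γ' Φ) {φ : OpenPartialHomeomorph T T'} (hφ : φ ∈ Φ)
    (hW : IsOpen W) (hW' : IsOpen W') {x : T} (hx : x ∈ φ.source) (hxW : x ∈ W)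
    (hxW' : φ x ∈ W') : ∃ ψ ∈ Φ, ψ.source ⊆ W ∧ ψ.target ⊆ W' ∧ x ∈ ψ.source ∧ ψ x = φ x := by
  refine ⟨_, hΦ.comp_mem φ hφ _ (Γ.restr_refl_mem hW) _ (Γ'.restr_refl_mem hW'), ?_, ?_, ?_, rfl⟩
  · intro y hy
    simp [hW.interior_eq] at hy
    exact hy.1.1
  · intro y hy
    simp [hW'.interior_eq] at hy
    exact hy.1
  · simp [hW.interior_eq, hW'.interior_eq, hx, hxW, hxW']

/-- A pair of a map of `Φ` between the open sets `W` and `W'` and a compact subset of its domain. -/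
structure IsCompactPiece (Φ : Set (OpenPartialHomeomorph T T')) (W : Set T) (W' : Set T')
    (p : OpenPartialHomeomorph T T' × Set T) : Prop where
  mem : p.1 ∈ Φ
  source_subset : p.1.source ⊆ W
  target_subset : p.1.target ⊆ W'
  isCompact : IsCompact p.2
  subset_source : p.2 ⊆ p.1.source

/-- Since `W'` meets every orbit, composing with an element of `Γ'` makes a map of `Φ` at a given
point of `Z` take its value in `W'`. Restriction, local compactness and compactness of `Z` do the
rest. -/
theorem exists_finite_pieces_source [LocallyCompactSpace T]
    [ClosedUnderRestriction Γ] [ClosedUnderRestriction Γ'] (hΦ : IsHaefligerEquivalence Γ Γ' Φ)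
    (hE : IsRecurrentSystem Γ W E) (hE' : IsRecurrentSystem Γ' W' E') {Z : Set T}
    (hZ : IsCompact Z) (hZW : Z ⊆ W) :
    ∃ F : Set (OpenPartialHomeomorph T T' × Set T), F.Finite ∧
      (∀ p ∈ F, IsCompactPiece Φ W W' p) ∧ Z ⊆ ⋃ p ∈ F, p.2 := by
  refine hZ.induction_on (p := fun Z => ∃ F : Set (OpenPartialHomeomorph T T' × Set T), F.Finite ∧
      (∀ p ∈ F, IsCompactPiece Φ W W' p) ∧ Z ⊆ ⋃ p ∈ F, p.2) ⟨∅, by simp⟩ ?_ ?_ ?_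
  · rintro s t hst ⟨F, hF, hp, ht⟩
    exact ⟨F, hF, hp, hst.trans ht⟩
  · rintro s t ⟨F, hF, hp, hs⟩ ⟨F', hF', hp', ht⟩
    refine ⟨F ∪ F', hF.union hF', fun p h => h.elim (hp p) (hp' p), ?_⟩
    rw [biUnion_union]
    exact union_subset_union hs ht
  · intro x hx
    obtain ⟨φ, hφ, hxφ⟩ := hΦ.cover_source x
    obtain ⟨g, hg, hxg, hgx⟩ := hE'.meets_orbits (φ x)
    have hmem : φ.trans g ∈ Φ := by
      simpa using hΦ.comp_mem φ hφ _ Γ.id_mem g hg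
    obtain ⟨ψ, hψ, hψW, hψW', hxψ, -⟩ := hΦ.restr_mem hmem hE.isOpen hE'.isOpen
      (x := x) (by rw [OpenPartialHomeomorph.trans_source]; exact ⟨hxφ, hxg⟩) (hZW hx) hgx
    obtain ⟨K, hKx, hKψ, hK⟩ := local_compact_nhds (ψ.open_source.mem_nhds hxψ)
    refine ⟨K, mem_nhdsWithin_of_mem_nhds hKx, {(ψ, K)}, finite_singleton _, ?_, by simp⟩
    rintro _ rfl
    exact ⟨hψ, hψW, hψW', hK, hKψ⟩

theorem exists_finite_pieces_target [LocallyCompactSpace T']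
    [ClosedUnderRestriction Γ] [ClosedUnderRestriction Γ'] (hΦ : IsHaefligerEquivalence Γ Γ' Φ)
    (hE : IsRecurrentSystem Γ W E) (hE' : IsRecurrentSystem Γ' W' E') {Z' : Set T'}
    (hZ : IsCompact Z') (hZW : Z' ⊆ W') :
    ∃ F : Set (OpenPartialHomeomorph T T' × Set T), F.Finite ∧
      (∀ p ∈ F, IsCompactPiece Φ W W' p) ∧ Z' ⊆ ⋃ p ∈ F, p.1 '' p.2 := by
  obtain ⟨F, hF, hp, hcov⟩ := exists_finite_pieces_source hΦ.symm hE' hE hZ hZW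
  refine ⟨(fun p => (p.1.symm, p.1 '' p.2)) '' F, hF.image _, ?_, ?_⟩
  · rintro _ ⟨p, hpF, rfl⟩
    obtain ⟨⟨φ, hφ, hφp⟩, h2, h3, h4, h5⟩ := hp p hpF
    refine ⟨by simpa [← hφp] using hφ, h3, h2, h4.image_of_continuousOn (p.1.continuousOn.mono h5),
      ?_⟩
    rintro _ ⟨x, hx, rfl⟩
    exact p.1.map_source (h5 hx)
  · intro y hy
    obtain ⟨p, hpF, hyp⟩ := mem_iUnion₂.1 (hcov hy)
    refine mem_iUnion₂.2 ⟨_, mem_image_of_mem _ hpF, p.1 y, mem_image_of_mem _ hyp, ?_⟩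
    exact p.1.left_inv ((hp p hpF).subset_source hyp)

/-- A composition of generators is transported by two maps of `Φ`, over compact sets, to
transformations of bounded length. -/
theorem exists_length_bound_of_word (hΦ : IsHaefligerEquivalence Γ Γ' Φ) [T2Space T]
    (hE : IsRecurrentSystem Γ W E) (hE' : IsRecurrentSystem Γ' W' E')
    {p q : OpenPartialHomeomorph T T' × Set T} (hp : IsCompactPiece Φ W W' p)
    (hq : IsCompactPiece Φ W W' q) {n : ℕ} {g : OpenPartialHomeomorph T T} (hg : g ∈ words E n) :
    ∃ C, ∀ v ∈ p.2, v ∈ g.source → g v ∈ q.2 → Reaches E' C (p.1 v) (q.1 (g v)) := by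
  obtain ⟨f, hf, hgf, hfg⟩ := words_extend hE.extends_to_closure n g hg
  -- The points of `g.source` in question need not form a compact set; passing to the closure, where
  -- the extension `f` is still defined, repairs this.
  have hQ : IsCompact (p.2 ∩ (closure g.source ∩ f ⁻¹' q.2)) :=
    hp.isCompact.inter_right
      ((f.continuousOn.mono hgf).preimage_isClosed_of_isClosed isClosed_closure
        hq.isCompact.isClosed)
  obtain ⟨C, hC⟩ : ∃ C, ∀ v ∈ p.2 ∩ (closure g.source ∩ f ⁻¹' q.2),
      Reaches E' C (p.1 v) (q.1 (f v)) := by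
    refine hQ.induction_on (p := fun s => ∃ C, ∀ v ∈ s, Reaches E' C (p.1 v) (q.1 (f v)))
      ⟨0, by simp⟩ ?_ ?_ ?_
    · rintro s t hst ⟨C, hC⟩
      exact ⟨C, fun v hv => hC v (hst hv)⟩
    · rintro s t ⟨C, hC⟩ ⟨C', hC'⟩
      refine ⟨max C C', fun v hv => hv.elim (fun h => (hC v h).mono (le_max_left _ _))
        fun h => (hC' v h).mono (le_max_right _ _)⟩
    · rintro v ⟨hvp, hvg, hvq⟩
      have hvs := hp.subset_source hvp
      have hmem : p.1.symm.trans (f.trans q.1) ∈ Γ' :=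
        hΦ.transition_mem' _ hp.mem _ (by
          simpa using hΦ.comp_mem q.1 hq.mem f hf _ Γ'.id_mem)
      obtain ⟨m, w, hw, hvw, heq⟩ := hE'.generates.locally_word _ hmem
        (fun y hy => hp.target_subset (by
          rw [OpenPartialHomeomorph.trans_source] at hy; exact hy.1))
        (fun y hy => hq.target_subset (by
          rw [OpenPartialHomeomorph.trans_target, OpenPartialHomeomorph.trans_target] at hy
          exact hy.1.1)) (p.1 v) (by
          simp only [OpenPartialHomeomorph.trans_source, mem_inter_iff, mem_preimage,
            OpenPartialHomeomorph.symm_source, p.1.left_inv hvs]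
          exact ⟨p.1.map_source hvs, hgf hvg, hq.subset_source hvq⟩)
      -- The same word `w` serves all points near `v`, so the length bound is locally constant.
      have hev : ∀ᶠ u in 𝓝 v, p.1 u ∈ w.source ∧
          p.1.symm.trans (f.trans q.1) (p.1 u) = w (p.1 u) ∧ u ∈ p.1.source := by
        have hc := p.1.continuousAt hvs
        filter_upwards [hc.eventually (w.open_source.mem_nhds hvw), hc.eventually heq,
          p.1.open_source.mem_nhds hvs] with u h1 h2 h3
        exact ⟨h1, h2, h3⟩
      refine ⟨_, mem_nhdsWithin_of_mem_nhds hev, m, ?_⟩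
      rintro u ⟨h1, h2, h3⟩
      refine ⟨w, hw, h1, ?_⟩
      rw [← h2]
      simp [p.1.left_inv h3]
  refine ⟨C, fun v hv hvg hvq => ?_⟩
  rw [← hfg hvg] at hvq ⊢
  exact hC v ⟨hv, subset_closure hvg, hvq⟩

/-- There are finitely many pieces and, as `E` is finite, finitely many words of length at most `n`;
the bounds for single words have a common upper bound. -/
theorem exists_length_bound (hΦ : IsHaefligerEquivalence Γ Γ' Φ) [T2Space T]
    (hE : IsRecurrentSystem Γ W E) (hE' : IsRecurrentSystem Γ' W' E')
    {F : Set (OpenPartialHomeomorph T T' × Set T)} (hF : F.Finite)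
    (hp : ∀ p ∈ F, IsCompactPiece Φ W W' p) (n : ℕ) :
    ∃ C, ∀ p ∈ F, ∀ q ∈ F, ∀ v ∈ p.2, ∀ u ∈ q.2, Reaches E n v u →
      Reaches E' C (p.1 v) (q.1 u) := by
  have key : ∀ᶠ C in Filter.atTop, ∀ p ∈ F, ∀ q ∈ F, ∀ g ∈ words E n,
      ∀ v ∈ p.2, v ∈ g.source → g v ∈ q.2 → Reaches E' C (p.1 v) (q.1 (g v)) := by
    refine (Filter.eventually_all_finite hF).2 fun p hpF =>
      (Filter.eventually_all_finite hF).2 fun q hqF =>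
      (Filter.eventually_all_finite (words_finite hE.finite n)).2 fun g hg => ?_
    obtain ⟨C, hC⟩ := exists_length_bound_of_word hΦ hE hE' (hp p hpF) (hp q hqF) hg
    filter_upwards [Filter.eventually_ge_atTop C] with D hD v h1 h2 h3
    exact (hC v h1 h2 h3).mono hD
  obtain ⟨C, hC⟩ := key.exists
  refine ⟨C, ?_⟩
  rintro p hpF q hqF v hv _ hu ⟨g, hg, hvg, rfl⟩
  exact hC p hpF q hqF g hg v hv hvg hu

theorem IsRecurrentSystem.exists_return (hE : IsRecurrentSystem Γ W E) :
    ∃ Z, IsCompact Z ∧ Z ⊆ W ∧ ∃ R, ∀ x ∈ W, ∃ z ∈ Z, Reaches E R x z := by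
  obtain ⟨V, -, hV, hVW, R, hR⟩ := hE.recurrent
  refine ⟨closure V, hV, hVW, R, fun x hx => ?_⟩
  obtain ⟨w, hw, hxw, hwV⟩ := hR x hx
  exact ⟨w x, subset_closure hwV, w, hw, hxw, rfl⟩

/-- Words of `E` are followed in `W'` by words of `E'` of proportional length. -/
theorem reaches_of_reaches (hE : IsRecurrentSystem Γ W E)
    {F : Set (OpenPartialHomeomorph T T' × Set T)} {R C : ℕ}
    (hR : ∀ x ∈ W, ∃ p ∈ F, ∃ z ∈ p.2, Reaches E R x z)
    (hC : ∀ p ∈ F, ∀ q ∈ F, ∀ v ∈ p.2, ∀ u ∈ q.2, Reaches E (R + 1 + R) v u →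
      Reaches E' C (p.1 v) (q.1 u)) {n : ℕ} {x y : T} (hxy : Reaches E n x y)
    {p : OpenPartialHomeomorph T T' × Set T} (hp : p ∈ F) {v : T} (hv : v ∈ p.2)
    (hvx : Reaches E R v x) :
    ∃ q ∈ F, ∃ z ∈ q.2, Reaches E R y z ∧ Reaches E' (C * n) (p.1 v) (q.1 z) := by
  obtain ⟨w, hw, hxw, hwy⟩ := hxy
  refine words_induction (P := fun n w => ∀ x, x ∈ w.source → w x = y →
    ∀ p ∈ F, ∀ v ∈ p.2, Reaches E R v x →
      ∃ q ∈ F, ∃ z ∈ q.2, Reaches E R y z ∧ Reaches E' (C * n) (p.1 v) (q.1 z)) ?_ ?_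
    n w hw x hxw hwy p hp v hv hvx
  · intro n x _ hxy p hp v hv hvx
    obtain rfl : x = y := hxy
    exact ⟨p, hp, v, hv, hvx.symm hE.symmetric, Reaches.refl _ _⟩
  · intro n e he w _ ih x hx hxy p hp v hv hvx
    rw [OpenPartialHomeomorph.trans_source] at hx
    obtain ⟨p₁, hp₁, v₁, hv₁, hev₁⟩ :=
      hR (e x) (hE.generates.target_subset e he (e.map_source hx.1))
    -- From `v` to `x`, one letter, then back to a piece: this is the origin of `R + 1 + R`.
    have h1 : Reaches E (R + 1 + R) v v₁ :=
      (hvx.trans (Reaches.cons he hx.1 (Reaches.refl 0 _))).trans hev₁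
    obtain ⟨q, hq, z, hz, hyz, hvz⟩ := ih (e x) hx.2 hxy p₁ hp₁ v₁ hv₁ (hev₁.symm hE.symmetric)
    exact ⟨q, hq, z, hz, hyz,
      ((hC p hp p₁ hp₁ v hv v₁ hv₁ h1).trans hvz).mono (by rw [Nat.mul_succ, add_comm])⟩

variable [MeasurableSpace T] [MeasurableSpace T']

/-- The measure of `W` is bounded by a multiple of the measure of a set which is reached from each
point of `W`. -/
theorem IsRecurrentSystem.measure_le_measuredCat [SecondCountableTopology T] [BorelSpace T]
    {Λ : Measure T} (hΛ : IsInvariantMeasure Γ Λ) (hE : IsRecurrentSystem Γ W E) (n : ℕ) :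
    Λ W ≤ (words E n).ncard * measuredCat Λ W E n := by
  have hne : (words E n).ncard ≠ 0 :=
    ((ncard_pos (words_finite hE.finite n)).2 ⟨_, refl_mem_words E n⟩).ne'
  refine ENNReal.le_mul_of_forall_lt (Or.inl (by exact_mod_cast hne))
    (Or.inl (ENNReal.natCast_ne_top _)) fun a ha b hb => ?_
  obtain ⟨S, hS, hSb, hW⟩ := exists_isOpen_reached_of_measuredCat_lt hb
  have hcov : W ⊆ ⋃ w ∈ words E n, w.source ∩ w ⁻¹' S := by
    intro x hx
    obtain ⟨_, hy, w, hw, hxw, rfl⟩ := hW x hx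
    exact mem_biUnion hw ⟨hxw, hy⟩
  refine (measure_mono hcov).trans
    ((measure_biUnion_le_card_mul Λ (words_finite hE.finite n) fun w hw => ?_).trans
      (mul_le_mul' ha.le hSb.le))
  -- Each `w` preserves the measure and sends its part of `W` into `S`.
  rw [← hΛ w (words_subset hE.generates.mem n w hw) _
    (w.isOpen_inter_preimage hS).measurableSet inter_subset_left]
  refine measure_mono ?_
  rintro _ ⟨x, hx, rfl⟩
  exact hx.2

/-- A point of `W'` first moves to a piece (`R'` steps), then follows in `W'` an `E`-word ending in
`S`. The shadowing path ends at the transport of a point within `R` steps of `S`, so `S` is enlarged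
by the words of length at most `R` before it is mapped by the pieces. -/
theorem exists_measuredCat_le [PolishSpace T] [LocallyCompactSpace T] [BorelSpace T]
    [PolishSpace T'] [LocallyCompactSpace T'] [BorelSpace T']
    [ClosedUnderRestriction Γ] [ClosedUnderRestriction Γ']
    {Λ : Measure T} (hΛ : IsInvariantMeasure Γ Λ)
    {Λ' : Measure T'} [SFinite Λ'] [Λ'.OuterRegular]
    (hΦ : IsHaefligerEquivalence Γ Γ' Φ)
    (hmp : ∀ φ ∈ Φ, ∀ U, IsOpen U → U ⊆ φ.source → Λ' (φ '' U) = Λ U)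
    (hE : IsRecurrentSystem Γ W E) (hE' : IsRecurrentSystem Γ' W' E') :
    ∃ (m B C : ℕ), ∀ n, measuredCat Λ' W' E' (B + C * n) ≤ m * measuredCat Λ W E n := by
  obtain ⟨Z, hZ, hZW, R, hR⟩ := hE.exists_return
  obtain ⟨Z', hZ', hZW', R', hR'⟩ := hE'.exists_return
  obtain ⟨F₁, hF₁, hp₁, hcov₁⟩ := exists_finite_pieces_source hΦ hE hE' hZ hZW
  obtain ⟨F₂, hF₂, hp₂, hcov₂⟩ := exists_finite_pieces_target hΦ hE hE' hZ' hZW'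
  obtain ⟨F, hF, hp, hcov, hcov'⟩ : ∃ F : Set (OpenPartialHomeomorph T T' × Set T), F.Finite ∧
      (∀ p ∈ F, IsCompactPiece Φ W W' p) ∧ Z ⊆ (⋃ p ∈ F, p.2) ∧ Z' ⊆ ⋃ p ∈ F, p.1 '' p.2 :=
    ⟨F₁ ∪ F₂, hF₁.union hF₂, fun p h => h.elim (hp₁ p) (hp₂ p),
      hcov₁.trans (biUnion_subset_biUnion_left subset_union_left),
      hcov₂.trans (biUnion_subset_biUnion_left subset_union_right)⟩
  obtain ⟨C, hC⟩ := exists_length_bound hΦ hE hE' hF hp (R + 1 + R)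
  have hret : ∀ x ∈ W, ∃ p ∈ F, ∃ z ∈ p.2, Reaches E R x z := by
    intro x hx
    obtain ⟨z, hz, hxz⟩ := hR x hx
    obtain ⟨p, hpF, hzp⟩ := mem_iUnion₂.1 (hcov hz)
    exact ⟨p, hpF, z, hzp, hxz⟩
  -- The `+ 1` keeps the factor nonzero when `F` is empty, as the limiting argument in `ℝ≥0∞`
  -- requires.
  refine ⟨(F ×ˢ words E R).ncard + 1, R', C, fun n => ?_⟩
  refine ENNReal.le_mul_of_forall_lt (Or.inl (by positivity))
    (Or.inl (ENNReal.natCast_ne_top _)) fun a ha b hb => ?_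
  obtain ⟨S, hS, hSb, hW⟩ := exists_isOpen_reached_of_measuredCat_lt hb
  have hopen : ∀ w : OpenPartialHomeomorph T T, IsOpen (w '' (w.source ∩ S)) :=
    fun w => w.isOpen_image_source_inter hS
  have hreach : ∀ y ∈ W', ∃ z ∈ ⋃ i ∈ F ×ˢ words E R,
      i.1.1 '' (i.1.1.source ∩ i.2 '' (i.2.source ∩ S)), Reaches E' (R' + C * n) y z := by
    intro y hy
    obtain ⟨z', hz', hyz'⟩ := hR' y hy
    obtain ⟨p, hpF, v, hv, rfl⟩ := mem_iUnion₂.1 (hcov' hz')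
    obtain ⟨s, hs, hvs⟩ := hW v ((hp p hpF).source_subset ((hp p hpF).subset_source hv))
    obtain ⟨q, hqF, z, hz, ⟨w, hw, hsw, hwz⟩, hvz⟩ :=
      reaches_of_reaches hE hret hC hvs hpF hv (Reaches.refl _ _)
    refine ⟨q.1 z, mem_iUnion₂.2 ⟨(q, w), ⟨hqF, hw⟩, z, ⟨(hp q hqF).subset_source hz, ?_⟩, rfl⟩,
      hyz'.trans hvz⟩
    exact ⟨s, ⟨hsw, hs⟩, hwz⟩
  refine (measuredCat_le_of_reaches hE'.isOpen ?_ hreach).trans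
    ((measure_biUnion_le_card_mul Λ' (hF.prod (words_finite hE.finite R)) ?_).trans
      (mul_le_mul' ((Nat.cast_le.2 (Nat.le_succ _)).trans ha.le) hSb.le))
  · exact isOpen_biUnion fun i _ => i.1.1.isOpen_image_source_inter (hopen i.2)
  · rintro ⟨p, w⟩ ⟨hpF, hw⟩
    rw [hmp p.1 (hp p hpF).mem _ (p.1.open_source.inter (hopen w)) inter_subset_left]
    refine (measure_mono inter_subset_right).trans ?_
    rw [hΛ w (words_subset hE.generates.mem R w hw) _ (w.open_source.inter hS).measurableSet
      inter_subset_left]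
    exact measure_mono inter_subset_right

theorem secondaryCat_le [PolishSpace T] [LocallyCompactSpace T] [BorelSpace T]
    [PolishSpace T'] [LocallyCompactSpace T'] [BorelSpace T']
    [ClosedUnderRestriction Γ] [ClosedUnderRestriction Γ']
    {Λ : Measure T} (hΛ : IsInvariantMeasure Γ Λ)
    {Λ' : Measure T'} [SFinite Λ'] [Λ'.OuterRegular] (hΛ' : IsInvariantMeasure Γ' Λ')
    (hΦ : IsHaefligerEquivalence Γ Γ' Φ)
    (hmp : ∀ φ ∈ Φ, ∀ U, IsOpen U → U ⊆ φ.source → Λ' (φ '' U) = Λ U)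
    (hE : IsRecurrentSystem Γ W E) (hE' : IsRecurrentSystem Γ' W' E') :
    secondaryCat Λ W E ≤ secondaryCat Λ' W' E' := by
  obtain ⟨m, B, C, h⟩ := exists_measuredCat_le hΛ hΦ hmp hE hE'
  set k := (words E' B).ncard
  have hbound : ∀ n, measuredCat Λ' W' E' ((B + C) * n) ≤
      ((k + 1) * (m + 1) : ℕ) * measuredCat Λ W E n := by
    intro n
    -- `B + C * n ≤ (B + C) * n` fails at `n = 0` unless `B = 0`. There the comparison goes through
    -- `Λ' W'`, which the category at length `B` controls up to the number `k` of words.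
    rcases n.eq_zero_or_pos with rfl | hn
    · calc measuredCat Λ' W' E' ((B + C) * 0) ≤ Λ' W' :=
            measuredCat_le_of_reaches hE'.isOpen hE'.isOpen fun x hx => ⟨x, hx, Reaches.refl _ _⟩
        _ ≤ k * measuredCat Λ' W' E' B := hE'.measure_le_measuredCat hΛ' B
        _ ≤ k * (m * measuredCat Λ W E 0) := by gcongr; exact h 0
        _ ≤ _ := by
            rw [← mul_assoc]
            gcongr
            exact_mod_cast Nat.mul_le_mul (Nat.le_succ k) (Nat.le_succ m)
    · calc measuredCat Λ' W' E' ((B + C) * n) ≤ measuredCat Λ' W' E' (B + C * n) :=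
            measuredCat_antitone _ _ _ (by nlinarith)
        _ ≤ m * measuredCat Λ W E n := h n
        _ ≤ _ := by
            gcongr
            exact (Nat.le_succ m).trans (Nat.le_mul_of_pos_left _ k.succ_pos)
  refine toAntisymmetrization_le_toAntisymmetrization_iff.2
    ⟨B + C, ((k + 1) * (m + 1) : ℕ), by positivity, fun n => ?_⟩
  have hN : (((k + 1) * (m + 1) : ℕ) : ℝ≥0∞) ≠ 0 := by positivity
  have hN' : (((k + 1) * (m + 1) : ℕ) : ℝ≥0∞) ≠ ∞ := ENNReal.natCast_ne_top _
  have := ENNReal.inv_le_inv.2 (hbound n)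
  rw [ENNReal.mul_inv (Or.inl hN) (Or.inl hN'), mul_comm, ← div_eq_mul_inv,
    ENNReal.div_le_iff hN hN', mul_comm] at this
  simpa using this

end Comparison

theorem mainTheorem10
    {T T' : Type*}
    [TopologicalSpace T] [PolishSpace T] [LocallyCompactSpace T] [MeasurableSpace T] [BorelSpace T]
    [TopologicalSpace T'] [PolishSpace T'] [LocallyCompactSpace T'] [MeasurableSpace T']
    [BorelSpace T']
    (Γ : StructureGroupoid T) [ClosedUnderRestriction Γ]
    (Γ' : StructureGroupoid T') [ClosedUnderRestriction Γ']
    (Λ : Measure T) [IsFiniteMeasureOnCompacts Λ] (hΛ : IsInvariantMeasure Γ Λ)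
    (Λ' : Measure T') [IsFiniteMeasureOnCompacts Λ'] (hΛ' : IsInvariantMeasure Γ' Λ')
    (Φ : Set (OpenPartialHomeomorph T T')) (hΦ : IsHaefligerEquivalence Γ Γ' Φ)
    (hmp : IsMeasurePreservingEquivalence Φ Λ Λ')
    (W : Set T) (E : Set (OpenPartialHomeomorph T T)) (hE : IsRecurrentSystem Γ W E)
    (W' : Set T') (E' : Set (OpenPartialHomeomorph T' T')) (hE' : IsRecurrentSystem Γ' W' E') :
    secondaryCat Λ W E = secondaryCat Λ' W' E' := by
  refine le_antisymm
    (secondaryCat_le hΛ hΛ' hΦ (fun φ hφ U hU => hmp φ hφ U hU.measurableSet) hE hE')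
    (secondaryCat_le hΛ' hΛ hΦ.symm ?_ hE' hE)
  -- Testing on open sets suffices: `φ.symm '' U` is open, hence measurable, and `hmp` applies to
  -- it.
  rintro _ ⟨φ, hφ, rfl⟩ U hU hUφ
  have hVo : IsOpen (φ.symm '' U) := φ.symm.isOpen_image_of_subset_source hU hUφ
  have hVs : φ.symm '' U ⊆ φ.source := by
    rintro _ ⟨y, hy, rfl⟩
    exact φ.map_target (hUφ hy)
  rw [← hmp φ hφ _ hVo.measurableSet hVs]
  congr 1
  exact φ.toPartialEquiv.image_symm_image_of_subset_target hUφ
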